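/- All codes are binary linear codes; $A_k(D)$ denotes the number of codewords of Hamming weight $k$ in a code $D$, and $D^\perp$ denotes the dual code. The extended code $\overline{D}$ of a code $D$ of length $n$ is the code of length $n+1$ obtained by appending to each codeword of $D$ one coordinate making the sum of all coordinates zero. A $t$-$(v,k,\lambda)$ design is a set of $v$ points with a set of $k$-subsets (blocks), where $1\le t\le k\le v$, such that every $t$-subset of points lies in exactly $\lambda$ blocks. **Theorem.** Let $m\ge 5$ be an odd integer and let $\mathcal C$ be a binary linear code of length $2^m-1$ with $A_0(\mathcal C)=1$ and $$\begin{aligned} A_{2^{m-1}-2^{(m+1)/2}}(\mathcal C)&=(2^m-1)\,2^{(m-5)/2}\,(2^{(m-3)/2}+1)(2^{m-1}-1)/3,\\ A_{2^{m-1}-2^{(m-1)/2}}(\mathcal C)&=(2^m-1)\,2^{(m-3)/2}\,(2^{(m-1)/2}+1)(5\cdot 2^{m-1}+4)/3,\\ A_{2^{m-1}}(\mathcal C)&=(2^m-1)(9\cdot 2^{2m-4}+3\cdot 2^{m-3}+1),\\ A_{2^{m-1}+2^{(m-1)/2}}(\mathcal C)&=(2^m-1)\,2^{(m-3)/2}\,(2^{(m-1)/2}-1)(5\cdot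 2^{m-1}+4)/3,\\ A_{2^{m-1}+2^{(m+1)/2}}(\mathcal C)&=(2^m-1)\,2^{(m-5)/2}\,(2^{(m-3)/2}-1)(2^{m-1}-1)/3, \end{aligned}$$ and $A_w(\mathcal C)=0$ for all other $w$. Let $\mathcal E=\overline{\mathcal C^\perp}$ be the extended code of $\mathcal C^\perp$ (of length $2^m$), and put $$u=\frac{2^{3m-4}-3\cdot 2^{2m-4}+2^{m-3}}{3},\quad v=\frac{5\cdot 2^{3m-2}+3\cdot 2^{2m-2}-2^{m+1}}{3},\quad w=2(2^m-1)(9\cdot 2^{2m-4}+3\cdot 2^{m-3}+1).$$ 1. For every $k\ge 1$ with $A_k(\mathcal E^\perp)\ne 0$, the supports of the codewords of weight $k$ in $\mathcal E^\perp$ are the blocks of a $3$-$(2^m,k,\lambda)$ design on the coordinate set, with $$\lambda=\frac{A_k(\mathcal E^\perp)\binom{k}{3}}{\binom{2^m}{3}},$$ where $A_k(\mathcal E^\perp)$ equals $1$ for $k\in\{0,2^m\}$, $u$ for $k=2^{m-1}\pm 2^{(m+1)/2}$, $v$ for $k=2^{m-1}\pm 2^{(m-1)/2}$, $w$ for $k=2^{m-1}$,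 and $0$ for every other $k$. 2. For every $k\ge 1$ with $A_k(\mathcal E)\ne 0$, the supports of the codewords of weight $k$ in $\mathcal E$ are the blocks of a $3$-$(2^m,k,\lambda)$ design on the coordinate set, with $$\lambda=\frac{A_k(\mathcal E)\binom{k}{3}}{\binom{2^m}{3}},$$ where, for $0\le k\le 2^m$, $$\begin{aligned}2^{3m+1}A_k(\mathcal E)={}&(1+(-1)^k)\binom{2^m}{k}+w\,\frac{1+(-1)^k}{2}(-1)^{\lfloor k/2\rfloor}\binom{2^{m-1}}{\lfloor k/2\rfloor}\\&+u\,S_{-2^{(m+1)/2}}(k)+v\,S_{-2^{(m-1)/2}}(k)+v\,S_{2^{(m-1)/2}}(k)+u\,S_{2^{(m+1)/2}}(k),\end{aligned}$$ $$S_r(k)=\sum_{i+j=k,\ i,j\ge 0}(-1)^i\binom{2^{m-1}+r}{i}\binom{2^{m-1}-r}{j}.$$ -/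

import Mathlib

/-- A binary linear code with coordinates indexed by `ι`. -/
abbrev BinaryCode (ι : Type*) := Submodule (ZMod 2) (ι → ZMod 2)

/-- The (Euclidean) dual code. -/
def dualCode {ι : Type*} [Fintype ι] (C : BinaryCode ι) : BinaryCode ι where
  carrier := {y | ∀ x ∈ C, ∑ i, x i * y i = 0}
  zero_mem' := by
    intro x _
    simp
  add_mem' := by
    intro y z hy hz x hx
    simp [mul_add, Finset.sum_add_distrib, hy x hx, hz x hx]
  smul_mem' := by
    intro a y hy x hx
    have h : ∑ i, x i * (a • y) i = a * ∑ i, x i * y i := by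
      rw [Finset.mul_sum]
      exact Finset.sum_congr rfl fun i _ => by simp [mul_left_comm]
    rw [h, hy x hx, mul_zero]

/-- The extended code: append to every codeword one overall parity check coordinate. -/
def extendedCode {n : ℕ} (C : BinaryCode (Fin n)) : BinaryCode (Fin (n + 1)) where
  carrier := {x | (fun i : Fin n => x i.castSucc) ∈ C ∧ ∑ i, x i = 0}
  zero_mem' := ⟨C.zero_mem, by simp⟩
  add_mem' := by
    rintro x y ⟨hx, hx0⟩ ⟨hy, hy0⟩
    exact ⟨C.add_mem hx hy, by simp [Finset.sum_add_distrib, hx0, hy0]⟩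
  smul_mem' := by
    rintro a x ⟨hx, hx0⟩
    exact ⟨C.smul_mem a hx, by simp [← Finset.mul_sum, hx0]⟩

/-- `A_k(C)`: the number of codewords of Hamming weight `k`. -/
noncomputable def weightCount {ι : Type*} [Fintype ι] (C : BinaryCode ι) (k : ℕ) : ℕ :=
  {c : ι → ZMod 2 | c ∈ C ∧ hammingNorm c = k}.ncard

/-- The support of a binary vector. -/
def wordSupport {ι : Type*} [Fintype ι] (c : ι → ZMod 2) : Finset ι :=
  Finset.univ.filter fun i => c i ≠ 0

/-- The set of supports of the codewords of Hamming weight `k`. -/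
def supportBlocks {ι : Type*} [Fintype ι] (C : BinaryCode ι) (k : ℕ) : Set (Finset ι) :=
  {B | ∃ c ∈ C, hammingNorm c = k ∧ wordSupport c = B}

/-- `(P, 𝓑)` is a (simple) `t`-`(v, k, l)` design. -/
structure IsDesign {P : Type*} [Fintype P] (t v k l : ℕ) (𝓑 : Set (Finset P)) : Prop where
  card_points : Fintype.card P = v
  one_le_t : 1 ≤ t
  t_le_k : t ≤ k
  k_le_v : k ≤ v
  card_block : ∀ B ∈ 𝓑, B.card = k
  card_containing : ∀ T : Finset P, T.card = t → {B ∈ 𝓑 | T ⊆ B}.ncard = l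

/-- The five-weight distribution (for odd `m ≥ 5`); all divisions in the exponents are exact. -/
def fiveWeightTable (m w : ℕ) : ℚ :=
  if w = 0 then 1
  else if w = 2 ^ (m - 1) - 2 ^ ((m + 1) / 2) then
    (2 ^ m - 1) * 2 ^ ((m - 5) / 2) * (2 ^ ((m - 3) / 2) + 1) * (2 ^ (m - 1) - 1) / 3
  else if w = 2 ^ (m - 1) - 2 ^ ((m - 1) / 2) then
    (2 ^ m - 1) * 2 ^ ((m - 3) / 2) * (2 ^ ((m - 1) / 2) + 1) * (5 * 2 ^ (m - 1) + 4) / 3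
  else if w = 2 ^ (m - 1) then
    (2 ^ m - 1) * (9 * 2 ^ (2 * m - 4) + 3 * 2 ^ (m - 3) + 1)
  else if w = 2 ^ (m - 1) + 2 ^ ((m - 1) / 2) then
    (2 ^ m - 1) * 2 ^ ((m - 3) / 2) * (2 ^ ((m - 1) / 2) - 1) * (5 * 2 ^ (m - 1) + 4) / 3
  else if w = 2 ^ (m - 1) + 2 ^ ((m + 1) / 2) then
    (2 ^ m - 1) * 2 ^ ((m - 5) / 2) * (2 ^ ((m - 3) / 2) - 1) * (2 ^ (m - 1) - 1) / 3
  else 0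

/-- `C` has the five-weight distribution. -/
def HasFiveWeightTable (m : ℕ) (C : BinaryCode (Fin (2 ^ m - 1))) : Prop :=
  ∀ w : ℕ, (weightCount C w : ℚ) = fiveWeightTable m w

/-- The coefficient `u`. -/
def coeffU (m : ℕ) : ℚ := (2 ^ (3 * m - 4) - 3 * 2 ^ (2 * m - 4) + 2 ^ (m - 3)) / 3

/-- The coefficient `v`. -/
def coeffV (m : ℕ) : ℚ := (5 * 2 ^ (3 * m - 2) + 3 * 2 ^ (2 * m - 2) - 2 ^ (m + 1)) / 3

/-- The coefficient `w`. -/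
def coeffW (m : ℕ) : ℚ := 2 * (2 ^ m - 1) * (9 * 2 ^ (2 * m - 4) + 3 * 2 ^ (m - 3) + 1)

/-- The weight distribution claimed for the dual of the extended dual code. -/
def dualExtendedTable (m k : ℕ) : ℚ :=
  if k = 0 then 1
  else if k = 2 ^ (m - 1) - 2 ^ ((m + 1) / 2) then coeffU m
  else if k = 2 ^ (m - 1) - 2 ^ ((m - 1) / 2) then coeffV m
  else if k = 2 ^ (m - 1) then coeffW m
  else if k = 2 ^ (m - 1) + 2 ^ ((m - 1) / 2) then coeffV m
  else if k = 2 ^ (m - 1) + 2 ^ ((m + 1) / 2) then coeffU m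
  else if k = 2 ^ m then 1
  else 0

/-- `∑_{i + j = k} (-1)^i (p choose i) (q choose j)`; terms with `i > p` or `j > q` vanish. -/
def signedSum (p q k : ℕ) : ℚ :=
  ∑ ij ∈ Finset.HasAntidiagonal.antidiagonal k, (-1) ^ ij.1 * (p.choose ij.1 : ℚ) * (q.choose ij.2 : ℚ)

/-- `2^(3m+1)` times the weight distribution claimed for the extended dual code. -/
def extendedDualFormula (m k : ℕ) : ℚ :=
  (1 + (-1) ^ k) * ((2 ^ m).choose k : ℚ)
    + coeffW m * ((1 + (-1) ^ k) / 2 * (-1) ^ (k / 2) * ((2 ^ (m - 1)).choose (k / 2) : ℚ))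
    + coeffU m * signedSum (2 ^ (m - 1) - 2 ^ ((m + 1) / 2)) (2 ^ (m - 1) + 2 ^ ((m + 1) / 2)) k
    + coeffV m * signedSum (2 ^ (m - 1) - 2 ^ ((m - 1) / 2)) (2 ^ (m - 1) + 2 ^ ((m - 1) / 2)) k
    + coeffV m * signedSum (2 ^ (m - 1) + 2 ^ ((m - 1) / 2)) (2 ^ (m - 1) - 2 ^ ((m - 1) / 2)) k
    + coeffU m * signedSum (2 ^ (m - 1) + 2 ^ ((m + 1) / 2)) (2 ^ (m - 1) - 2 ^ ((m + 1) / 2)) k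

open Finset

/-! Let E be the extended dual code and D its dual. Words of D arise from words c of C either as (c,
0) or as (c + 1, 1), so the weight distribution of D is that of C symmetrised under k ↦ 2^m - k. In
particular D contains the all-one word, has 2^(3m+1) words, and has at most five weights apart from
0 and 2^m.

The dual distance of D comes from a single power moment. For r = 6, the moment ∑ (2^m - 2 wt(y))^r
over D equals |D| times the number of r-tuples of coordinates whose unit vectors sum to a word of E.
From the weight distribution, the sixth moment per word equals that of the full space, where only
the sum 0 counts. Hence no 6-tuple sums to a nonzero word of E. All weights in E are even, and any
word of weight at most 6 is such a sum after padding with repeated coordinates, so E has minimum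
distance at least 8 (`eq_zero_of_hammingNorm_le_seven`).

The designs then follow from an Assmus–Mattson argument (`sum_codewords_eq_of_card_eq`). A function
of the weight on T and of the total weight can be interpolated at the relevant words by a
combination of characters of weight at most |T| + 5 - 1 = 7 when |T| = 3. Such combinations have the
same average over D as over the full space, where permuting coordinates shows that only |T| matters.
Applied to an indicator this gives the designs in D; applied to the terms of a local MacWilliams
identity (`card_mul_card_dualCode_eq`) it gives those in E. That identity with T empty also yields
the weight distribution of E. -/

/-- The nontrivial additive character of `ZMod 2`. -/
def binSign (a : ZMod 2) : ℚ := if a = 0 then 1 else -1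

theorem binSign_zero : binSign 0 = 1 := by simp [binSign]

theorem binSign_one : binSign 1 = -1 := by simp [binSign]

theorem binSign_add : ∀ a b : ZMod 2, binSign (a + b) = binSign a * binSign b := by
  intro a b
  fin_cases a <;> fin_cases b <;> simp [binSign] <;> rfl

theorem ZMod.two_eq_one_of_ne_zero : ∀ {a : ZMod 2}, a ≠ 0 → a = 1 := by decide

theorem ZMod.sum_two {M : Type*} [AddCommMonoid M] (f : ZMod 2 → M) :
    ∑ a : ZMod 2, f a = f 0 + f 1 := Fin.sum_univ_two f

theorem binSign_sum {α : Type*} (s : Finset α) (f : α → ZMod 2) :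
    binSign (∑ i ∈ s, f i) = ∏ i ∈ s, binSign (f i) := by
  classical
  induction s using Finset.induction_on with
  | empty => simp [binSign_zero]
  | insert a s ha ih => rw [sum_insert ha, prod_insert ha, binSign_add, ih]

/-! ### Characters, duality and functions of low degree -/

section General

variable {ι : Type*} [Fintype ι]

/-- The finset of codewords of a code. -/
noncomputable def codewords (D : BinaryCode ι) : Finset (ι → ZMod 2) :=
  (D : Set (ι → ZMod 2)).toFinite.toFinset

@[simp] theorem mem_codewords {D : BinaryCode ι} {x : ι → ZMod 2} :
    x ∈ codewords D ↔ x ∈ D := by simp [codewords]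

theorem codewords_top [DecidableEq ι] : codewords (⊤ : BinaryCode ι) = univ := by
  ext x; simp

theorem card_codewords_pos (D : BinaryCode ι) : 0 < #(codewords D) :=
  card_pos.2 ⟨0, mem_codewords.2 D.zero_mem⟩

theorem weightCount_eq_card (D : BinaryCode ι) (k : ℕ) :
    weightCount D k = #{x ∈ codewords D | hammingNorm x = k} := by
  rw [weightCount, ← Set.ncard_coe_finset]
  congr 1
  ext x; simp

theorem mem_dualCode {D : BinaryCode ι} {z : ι → ZMod 2} :
    z ∈ dualCode D ↔ ∀ x ∈ D, ∑ i, x i * z i = 0 := Iff.rfl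

/-- The character of `ι → ZMod 2` attached to a vector. -/
def binChar (z y : ι → ZMod 2) : ℚ := binSign (∑ i, y i * z i)

theorem binChar_add_right (z x y : ι → ZMod 2) :
    binChar z (x + y) = binChar z x * binChar z y := by
  simp [binChar, add_mul, sum_add_distrib, binSign_add]

theorem binChar_add_left (z z' y : ι → ZMod 2) :
    binChar (z + z') y = binChar z y * binChar z' y := by
  simp [binChar, mul_add, sum_add_distrib, binSign_add]

theorem binChar_zero_left (y : ι → ZMod 2) : binChar 0 y = 1 := by
  simp [binChar, binSign_zero]

theorem binChar_eq_prod (z y : ι → ZMod 2) : binChar z y = ∏ i, binSign (y i * z i) :=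
  binSign_sum _ _

theorem binChar_single [DecidableEq ι] (i : ι) (y : ι → ZMod 2) :
    binChar (Pi.single i 1) y = binSign (y i) := by
  rw [binChar]
  congr 1
  simp [Pi.single_apply]

theorem binChar_sum {α : Type*} (s : Finset α) (z : α → ι → ZMod 2) (y : ι → ZMod 2) :
    binChar (∑ j ∈ s, z j) y = ∏ j ∈ s, binChar (z j) y := by
  classical
  induction s using Finset.induction_on with
  | empty => simp [binChar_zero_left]
  | insert a s ha ih => rw [sum_insert ha, prod_insert ha, binChar_add_left, ih]

theorem sum_binChar_of_mem {D : BinaryCode ι} {z : ι → ZMod 2} (hz : z ∈ dualCode D) :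
    ∑ y ∈ codewords D, binChar z y = #(codewords D) := by
  rw [sum_congr rfl (g := fun _ => (1 : ℚ))]
  · simp
  · intro y hy
    rw [binChar, mem_dualCode.1 hz y (mem_codewords.1 hy), binSign_zero]

/-- Translation by a codeword on which the character is -1 permutes the code and negates the sum. -/
theorem sum_binChar_of_notMem {D : BinaryCode ι} {z : ι → ZMod 2} (hz : z ∉ dualCode D) :
    ∑ y ∈ codewords D, binChar z y = 0 := by
  rw [mem_dualCode] at hz
  push Not at hz
  obtain ⟨x, hx, hxz⟩ := hz
  have hchar : binChar z x = -1 := by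
    rw [binChar, ZMod.two_eq_one_of_ne_zero hxz, binSign_one]
  have h : ∑ y ∈ codewords D, binChar z y = ∑ y ∈ codewords D, binChar z (x + y) := by
    symm
    refine sum_bij (fun y _ => x + y) ?_ ?_ ?_ ?_
    · intro y hy
      exact mem_codewords.2 (D.add_mem hx (mem_codewords.1 hy))
    · intro a _ b _ hab
      exact add_left_cancel hab
    · intro b hb
      exact ⟨b - x, mem_codewords.2 (D.sub_mem (mem_codewords.1 hb) hx), by abel⟩
    · intro y _
      rfl
  simp only [binChar_add_right, ← mul_sum, hchar] at h
  linarith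

theorem eq_zero_of_mem_dualCode_top [DecidableEq ι] {z : ι → ZMod 2}
    (hz : z ∈ dualCode (⊤ : BinaryCode ι)) : z = 0 := by
  funext i
  simpa [Pi.single_apply] using mem_dualCode.1 hz (Pi.single i 1) trivial

/-- A vector outside D is separated from D by a linear functional, and every functional is the
pairing with some vector, which then lies in the dual. -/
theorem dualCode_dualCode (D : BinaryCode ι) : dualCode (dualCode D) = D := by
  classical
  refine le_antisymm (fun x hx => ?_) (fun x hx => ?_)
  · by_contra hxD
    obtain ⟨f, hf, hD⟩ := Submodule.exists_le_ker_of_notMem hxD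
    have hrep : ∀ y, f y = ∑ i, y i * f (Pi.single i 1) := by
      intro y
      conv_lhs => rw [← Finset.univ_sum_single y, map_sum]
      refine sum_congr rfl fun i _ => ?_
      rw [← smul_eq_mul, ← map_smul, ← Pi.single_smul]
      simp
    refine hf ?_
    rw [hrep, ← mem_dualCode.1 hx (fun i => f (Pi.single i 1)) ?_]
    · exact sum_congr rfl fun i _ => mul_comm _ _
    · intro y hy
      rw [← hrep]
      exact hD hy
  · intro y hy
    rw [← mem_dualCode.1 hy x hx]
    exact sum_congr rfl fun i _ => mul_comm _ _

/-- The functions spanned by the characters of vectors of weight at most `d`. -/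
def charSpan (ι : Type*) [Fintype ι] (d : ℕ) : Submodule ℚ ((ι → ZMod 2) → ℚ) :=
  Submodule.span ℚ {g | ∃ z : ι → ZMod 2, hammingNorm z ≤ d ∧ g = binChar z}

theorem hammingNorm_add_le' (x y : ι → ZMod 2) :
    hammingNorm (x + y) ≤ hammingNorm x + hammingNorm y := by
  have h := hammingDist_triangle (x + y) y 0
  rw [hammingDist_zero_right, hammingDist_zero_right, hammingDist_comm,
    hammingDist_eq_hammingNorm, show -y + (x + y) = x by abel] at h
  exact h

theorem charSpan_mono {a b : ℕ} (h : a ≤ b) : charSpan ι a ≤ charSpan ι b :=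
  Submodule.span_mono fun _ ⟨z, hz, hg⟩ => ⟨z, hz.trans h, hg⟩

/-- The product of two characters belongs to the sum of their vectors, and weight is subadditive; so
`charSpan` filters functions like polynomial degree. -/
theorem mul_mem_charSpan {a b : ℕ} {f g : (ι → ZMod 2) → ℚ} (hf : f ∈ charSpan ι a)
    (hg : g ∈ charSpan ι b) : f * g ∈ charSpan ι (a + b) := by
  have h := Submodule.mul_mem_mul hf hg
  rw [charSpan, charSpan, Submodule.span_mul_span] at h
  refine Submodule.span_mono ?_ h
  rintro _ ⟨_, ⟨x, hx, rfl⟩, _, ⟨y, hy, rfl⟩, rfl⟩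
  exact ⟨x + y, (hammingNorm_add_le' x y).trans (add_le_add hx hy),
    funext fun v => (binChar_add_left x y v).symm⟩

theorem one_mem_charSpan (d : ℕ) : (1 : (ι → ZMod 2) → ℚ) ∈ charSpan ι d :=
  Submodule.subset_span ⟨0, by simp, funext fun v => (binChar_zero_left v).symm⟩

theorem pow_mem_charSpan {f : (ι → ZMod 2) → ℚ} (hf : f ∈ charSpan ι 1) (r : ℕ) :
    f ^ r ∈ charSpan ι r := by
  induction r with
  | zero => simpa using one_mem_charSpan 0
  | succ r ih => rw [pow_succ]; exact mul_mem_charSpan ih hf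

theorem eval_mem_charSpan {f : (ι → ZMod 2) → ℚ} (hf : f ∈ charSpan ι 1) {d : ℕ}
    {p : Polynomial ℚ} (hp : p.natDegree ≤ d) : (fun y => p.eval (f y)) ∈ charSpan ι d := by
  have h : (fun y => p.eval (f y)) = ∑ i ∈ range (d + 1), p.coeff i • f ^ i := by
    funext y
    rw [Polynomial.eval_eq_sum_range' (Nat.lt_succ_of_le hp)]
    simp
  rw [h]
  exact Submodule.sum_mem _ fun i hi => Submodule.smul_mem _ _
    (charSpan_mono (Nat.lt_succ_iff.1 (mem_range.1 hi)) (pow_mem_charSpan hf i))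

theorem sum_binSign_mem_charSpan [DecidableEq ι] (T : Finset ι) :
    (fun y : ι → ZMod 2 => ∑ i ∈ T, binSign (y i)) ∈ charSpan ι 1 := by
  have h : (fun y : ι → ZMod 2 => ∑ i ∈ T, binSign (y i)) =
      ∑ i ∈ T, binChar (Pi.single i 1) := by
    funext y
    simp [binChar_single]
  rw [h]
  refine Submodule.sum_mem _ fun i _ => Submodule.subset_span ⟨_, ?_, rfl⟩
  rw [hammingNorm]
  refine (card_le_card (t := {i}) fun j hj => ?_).trans (by simp)
  by_contra hji
  simp_all

/-- A code with dual distance more than `d` behaves like the whole space with respect to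
functions in the span of the characters of weight at most `d`. -/
theorem average_eq_of_mem_charSpan [DecidableEq ι] {D : BinaryCode ι} {d : ℕ}
    (hD : ∀ z ∈ dualCode D, hammingNorm z ≤ d → z = 0) {g : (ι → ZMod 2) → ℚ}
    (hg : g ∈ charSpan ι d) :
    2 ^ Fintype.card ι * ∑ y ∈ codewords D, g y = #(codewords D) * ∑ y, g y := by
  induction hg using Submodule.span_induction with
  | mem g hg =>
    obtain ⟨z, hz, rfl⟩ := hg
    rw [← codewords_top]
    by_cases h : z = 0
    · subst h
      rw [sum_binChar_of_mem (Submodule.zero_mem _), sum_binChar_of_mem (Submodule.zero_mem _),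
        codewords_top]
      simp [mul_comm]
    · rw [sum_binChar_of_notMem fun h' => h (hD z h' hz),
        sum_binChar_of_notMem fun h' => h (eq_zero_of_mem_dualCode_top h')]
      simp
  | zero => simp
  | add x y _ _ hx hy => simp [sum_add_distrib, mul_add, hx, hy]
  | smul a x _ hx =>
    simp only [Pi.smul_apply, smul_eq_mul, ← mul_sum]
    rw [mul_left_comm, hx, mul_left_comm]

end General

/-! ### Local weight distributions, the MacWilliams identity and Assmus–Mattson -/

section Local

variable {ι : Type*} [Fintype ι]

theorem sum_binSign_eq {α : Type*} (T : Finset α) (y : α → ZMod 2) :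
    ∑ i ∈ T, binSign (y i) = #T - 2 * #{i ∈ T | y i ≠ 0} := by
  have h : ∀ i ∈ T, binSign (y i) = 1 - 2 * (if y i ≠ 0 then 1 else 0) := by
    intro i _
    unfold binSign
    split_ifs <;> first | contradiction | norm_num
  rw [sum_congr rfl h, sum_sub_distrib, ← mul_sum, sum_boole]
  simp

theorem sum_univ_binSign_eq (y : ι → ZMod 2) :
    ∑ i, binSign (y i) = Fintype.card ι - 2 * hammingNorm y := by
  simpa [hammingNorm] using sum_binSign_eq univ y

theorem sum_binSign_perm [DecidableEq ι] {T T' : Finset ι} (hT : #T = #T') (F : ℚ → ℚ → ℚ) :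
    ∑ y : ι → ZMod 2, F (∑ i ∈ T, binSign (y i)) (∑ i, binSign (y i)) =
      ∑ y : ι → ZMod 2, F (∑ i ∈ T', binSign (y i)) (∑ i, binSign (y i)) := by
  obtain ⟨σ, rfl⟩ := Equiv.Perm.exists_map_finset_eq T T' hT
  refine Fintype.sum_equiv (Equiv.arrowCongr σ (Equiv.refl _)) _ _ fun y => ?_
  congr 1
  · simp
  · exact Fintype.sum_equiv σ _ _ fun i => by simp

theorem Lagrange.natDegree_basis_le {F α : Type*} [Field F] [DecidableEq α] {s : Finset α}
    {v : α → F} {i : α} (hv : Set.InjOn v s) (hi : i ∈ s) :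
    (Lagrange.basis s v i).natDegree ≤ #s - 1 :=
  Polynomial.natDegree_le_of_degree_le (Lagrange.degree_basis hv hi).le

/-- If the dual distance of `D` exceeds `d` and the codewords other than `0` and `1` have few
weights, then the joint distribution of the weight and the weight on a small set `T` of coordinates
depends only on the size of `T`. -/
theorem sum_codewords_eq_of_card_eq [DecidableEq ι] {D : BinaryCode ι} {d : ℕ}
    (hD : ∀ z ∈ dualCode D, hammingNorm z ≤ d → z = 0) {W : Finset ℕ}
    (hW : ∀ y ∈ D, y = 0 ∨ y = 1 ∨ hammingNorm y ∈ W) {T T' : Finset ι} (hT : #T = #T')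
    (hd : #T + #W ≤ d + 1) (h : ℕ → ℕ → ℚ) :
    ∑ y ∈ codewords D, h #{i ∈ T | y i ≠ 0} (hammingNorm y) =
      ∑ y ∈ codewords D, h #{i ∈ T' | y i ≠ 0} (hammingNorm y) := by
  set N := Fintype.card ι
  set t := #T with ht
  let v₁ : ℕ → ℚ := fun b => t - 2 * b
  let v₂ : ℕ → ℚ := fun b => N - 2 * b
  have hv₁ : ∀ s : Set ℕ, Set.InjOn v₁ s := by
    intro s a _ b _ hab
    have : (a : ℚ) = b := by simp only [v₁] at hab; linarith
    exact_mod_cast this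
  have hv₂ : ∀ s : Set ℕ, Set.InjOn v₂ s := by
    intro s a _ b _ hab
    have : (a : ℚ) = b := by simp only [v₂] at hab; linarith
    exact_mod_cast this
  -- Two-variable Lagrange interpolation of `h`. The nodes `v₁ b` and `v₂ w` are the values of the
  -- sign sums over a `t`-set and over all coordinates at weights `b` and `w`.
  let F : ℚ → ℚ → ℚ := fun x z => ∑ b ∈ range (t + 1), ∑ w ∈ W,
    h b w * ((Lagrange.basis (range (t + 1)) v₁ b).eval x * (Lagrange.basis W v₂ w).eval z)
  have hF : ∀ a ∈ range (t + 1), ∀ w ∈ W, F (v₁ a) (v₂ w) = h a w := by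
    intro a ha w hw
    simp only [F]
    rw [sum_eq_single_of_mem a ha, sum_eq_single_of_mem w hw,
      Lagrange.eval_basis_self (hv₁ _) ha, Lagrange.eval_basis_self (hv₂ _) hw]
    · ring
    · intro b _ hb
      rw [Lagrange.eval_basis_of_ne hb hw]; ring
    · intro b _ hb
      refine sum_eq_zero fun w _ => ?_
      rw [Lagrange.eval_basis_of_ne hb ha]; ring
  let q : Finset ι → (ι → ZMod 2) → ℚ := fun S y =>
    F (∑ i ∈ S, binSign (y i)) (∑ i, binSign (y i))
  have hq : ∀ S, q S ∈ charSpan ι d := by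
    intro S
    have : q S = ∑ b ∈ range (t + 1), ∑ w ∈ W, h b w •
        ((fun y => (Lagrange.basis (range (t + 1)) v₁ b).eval (∑ i ∈ S, binSign (y i))) *
          fun y => (Lagrange.basis W v₂ w).eval (∑ i, binSign (y i))) := by
      funext y
      simp [q, F]
    rw [this]
    refine Submodule.sum_mem _ fun b hb => Submodule.sum_mem _ fun w hw =>
      Submodule.smul_mem _ _ ?_
    -- Degree `t` in the local sum and `#W - 1` in the total one; nonemptiness of `W` keeps the
    -- subtraction honest.
    have hpos : 0 < #W := card_pos.2 ⟨w, hw⟩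
    refine charSpan_mono (a := t + (#W - 1)) (by omega) (mul_mem_charSpan ?_ ?_)
    · refine eval_mem_charSpan (sum_binSign_mem_charSpan S) ?_
      simpa using Lagrange.natDegree_basis_le (hv₁ _) hb
    · exact eval_mem_charSpan (sum_binSign_mem_charSpan univ)
        (Lagrange.natDegree_basis_le (hv₂ _) hw)
  -- Pass from the code to the full space, permute coordinates there, and return.
  have hsum : ∑ y ∈ codewords D, q T y = ∑ y ∈ codewords D, q T' y := by
    have h₁ := average_eq_of_mem_charSpan hD (hq T)
    rw [sum_binSign_perm hT F, ← average_eq_of_mem_charSpan hD (hq T')] at h₁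
    exact mul_left_cancel₀ (by positivity) h₁
  have hval : ∀ S : Finset ι, #S = t → ∀ y, q S y =
      F (v₁ #{i ∈ S | y i ≠ 0}) (v₂ (hammingNorm y)) := by
    intro S hS y
    simp only [q, v₁, v₂, sum_binSign_eq, hS, hammingNorm, card_univ, N]
  -- The words 0 and 1 need not be interpolated: whatever the error there, it is the same for `T`
  -- and `T'`. This is why their weights do not count in `#W`.
  have hdiff : ∀ y ∈ codewords D,
      h #{i ∈ T | y i ≠ 0} (hammingNorm y) - q T y =
        h #{i ∈ T' | y i ≠ 0} (hammingNorm y) - q T' y := by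
    intro y hy
    rw [hval T rfl, hval T' hT.symm]
    rcases hW y (mem_codewords.1 hy) with rfl | rfl | hy
    · simp
    · simp [← hT, ← ht]
    · have hlt : ∀ S : Finset ι, #S = t → #{i ∈ S | y i ≠ 0} ∈ range (t + 1) := fun S hS => by
        have := card_filter_le S (fun i => y i ≠ 0)
        simp only [mem_range]; omega
      rw [hF _ (hlt T rfl) _ hy, hF _ (hlt T' hT.symm) _ hy]
      simp
  have := sum_congr rfl hdiff
  rw [sum_sub_distrib, sum_sub_distrib, hsum] at this
  linarith

theorem prod_comp_word {α M : Type*} [CommMonoid M] (S : Finset α) (y : α → ZMod 2)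
    (g : ZMod 2 → M) :
    ∏ i ∈ S, g (y i) =
      g 0 ^ (#S - #{i ∈ S | y i ≠ 0}) * g 1 ^ #{i ∈ S | y i ≠ 0} := by
  have h₀ : #S - #{i ∈ S | y i ≠ 0} = #{i ∈ S | ¬ y i ≠ 0} := by
    have := card_filter_add_card_filter_not (s := S) (fun i => y i ≠ 0)
    omega
  rw [h₀, ← prod_filter_mul_prod_filter_not S (fun i => y i ≠ 0), mul_comm]
  congr 1
  · refine prod_eq_pow_card fun i hi => ?_
    rw [not_not.1 (mem_filter.1 hi).2]
  · refine prod_eq_pow_card fun i hi => ?_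
    rw [ZMod.two_eq_one_of_ne_zero (mem_filter.1 hi).2]

open Polynomial in
/-- The weight enumerator, twisted by a character, of the vectors of length `n` whose support
contains a given set of `t` coordinates; the character is given by a vector of weight `w` having
weight `a` on the set. -/
noncomputable def localEnumerator (n t a w : ℕ) : ℚ[X] :=
  (X ^ (t - a) * (-X) ^ a) * ((1 + X) ^ (n - t - (w - a)) * (1 - X) ^ (w - a))

-- The sum factors over coordinates: with s = ±1 the sign of `y i`, a coordinate in `T` contributes
-- s X and any other contributes 1 + s X.
open Polynomial in
theorem sum_binChar_mul_X_pow [DecidableEq ι] (T : Finset ι) (y : ι → ZMod 2) :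
    (∑ x : ι → ZMod 2, if ∀ i ∈ T, x i ≠ 0 then C (binChar x y) * X ^ hammingNorm x else 0) =
      localEnumerator (Fintype.card ι) #T #{i ∈ T | y i ≠ 0} (hammingNorm y) := by
  let f : ι → ZMod 2 → ℚ[X] := fun i a =>
    if a = 0 then (if i ∈ T then 0 else 1) else C (binSign (y i)) * X
  have hterm : ∀ x : ι → ZMod 2,
      (if ∀ i ∈ T, x i ≠ 0 then C (binChar x y) * X ^ hammingNorm x else 0) =
        ∏ i, f i (x i) := by
    intro x
    split_ifs with hx
    · rw [binChar_eq_prod, hammingNorm, map_prod]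
      have : (X : ℚ[X]) ^ #{i | x i ≠ 0} = ∏ i, if x i ≠ 0 then X else 1 := by
        rw [prod_ite]; simp
      rw [this, ← prod_mul_distrib]
      refine prod_congr rfl fun i _ => ?_
      by_cases hi : x i = 0
      · have : i ∉ T := fun h => hx i h hi
        simp [f, hi, this, binSign_zero]
      · simp [f, ZMod.two_eq_one_of_ne_zero hi]
    · push Not at hx
      obtain ⟨i, hi, hxi⟩ := hx
      exact (prod_eq_zero (mem_univ i) (by simp [f, hi, hxi])).symm
  have hprod := prod_univ_sum (fun _ : ι => (univ : Finset (ZMod 2))) f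
  rw [Fintype.piFinset_univ] at hprod
  rw [sum_congr rfl fun x _ => hterm x, ← hprod]
  have hfac : ∀ i, ∑ a, f i a =
      if i ∈ T then C (binSign (y i)) * X else 1 + C (binSign (y i)) * X := by
    intro i
    rw [ZMod.sum_two]
    by_cases hi : i ∈ T <;> simp [f, hi]
  have hcompl : #{i ∈ Tᶜ | y i ≠ 0} = hammingNorm y - #{i ∈ T | y i ≠ 0} := by
    have : hammingNorm y = #{i ∈ T | y i ≠ 0} + #{i ∈ Tᶜ | y i ≠ 0} := by
      rw [hammingNorm, ← card_union_of_disjoint, ← filter_union, union_compl]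
      exact disjoint_filter_filter disjoint_compl_right
    omega
  rw [prod_congr rfl fun i _ => hfac i, prod_ite]
  simp only [filter_mem_eq_inter, univ_inter]
  rw [show ({i | i ∉ T} : Finset ι) = Tᶜ by ext; simp,
    prod_comp_word T y (fun a => C (binSign a) * X),
    prod_comp_word Tᶜ y (fun a => 1 + C (binSign a) * X), hcompl, card_compl, localEnumerator]
  simp [binSign_zero, binSign_one, sub_eq_add_neg]

theorem sum_binChar_eq_coeff [DecidableEq ι] (T : Finset ι) (k : ℕ) (y : ι → ZMod 2) :
    ∑ x : ι → ZMod 2 with hammingNorm x = k ∧ ∀ i ∈ T, x i ≠ 0, binChar x y =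
      (localEnumerator (Fintype.card ι) #T #{i ∈ T | y i ≠ 0} (hammingNorm y)).coeff k := by
  rw [← sum_binChar_mul_X_pow, Polynomial.finsetSum_coeff, sum_filter]
  refine sum_congr rfl fun x _ => ?_
  by_cases h : ∀ i ∈ T, x i ≠ 0
  · rw [if_pos h, Polynomial.coeff_C_mul, Polynomial.coeff_X_pow]
    by_cases hk : hammingNorm x = k
    · rw [if_pos ⟨hk, h⟩, if_pos hk.symm, mul_one]
    · rw [if_neg fun h' => hk h'.1, if_neg (Ne.symm hk), mul_zero]
  · rw [if_neg h, if_neg fun h' => h h'.2, Polynomial.coeff_zero]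

/-- A local form of the MacWilliams identity. -/
theorem card_mul_card_dualCode_eq [DecidableEq ι] (D : BinaryCode ι) (T : Finset ι) (k : ℕ) :
    (#(codewords D) : ℚ) *
        #{x ∈ codewords (dualCode D) | hammingNorm x = k ∧ ∀ i ∈ T, x i ≠ 0} =
      ∑ y ∈ codewords D,
        (localEnumerator (Fintype.card ι) #T #{i ∈ T | y i ≠ 0} (hammingNorm y)).coeff k := by
  classical
  simp_rw [← sum_binChar_eq_coeff]
  -- After exchanging the sums, orthogonality keeps exactly the vectors of the dual code.
  rw [sum_comm]
  have : ∀ x : ι → ZMod 2, ∑ y ∈ codewords D, binChar x y =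
      if x ∈ dualCode D then (#(codewords D) : ℚ) else 0 := by
    intro x
    split_ifs with hx
    · exact sum_binChar_of_mem hx
    · exact sum_binChar_of_notMem hx
  simp_rw [this]
  rw [← sum_filter, sum_const, nsmul_eq_mul, mul_comm]
  congr 3
  ext x
  simp [and_comm]

theorem wordSupport_injective : Function.Injective (wordSupport (ι := ι)) := by
  intro x y hxy
  funext i
  have h : x i ≠ 0 ↔ y i ≠ 0 := by
    simpa [wordSupport] using congrArg (i ∈ ·) hxy
  by_cases hx : x i = 0
  · rw [hx, not_not.1 (mt h.2 (not_not.2 hx))]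
  · rw [ZMod.two_eq_one_of_ne_zero hx, ZMod.two_eq_one_of_ne_zero (h.1 hx)]

theorem card_filter_subset_wordSupport [DecidableEq ι] (y : ι → ZMod 2) (t : ℕ) :
    #{T ∈ powersetCard t univ | ∀ i ∈ T, y i ≠ 0} = (hammingNorm y).choose t := by
  rw [hammingNorm, ← card_powersetCard]
  congr 1
  ext T
  simp only [mem_filter, mem_powersetCard, true_and, subset_iff, mem_univ]
  tauto

theorem isDesign_supportBlocks [DecidableEq ι] (D : BinaryCode ι) {t k l : ℕ} (ht : 1 ≤ t)
    (htk : t ≤ k) (hk : k ≤ Fintype.card ι)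
    (h : ∀ T : Finset ι, #T = t →
      #{x ∈ codewords D | hammingNorm x = k ∧ ∀ i ∈ T, x i ≠ 0} = l) :
    IsDesign t (Fintype.card ι) k l (supportBlocks D k) where
  card_points := rfl
  one_le_t := ht
  t_le_k := htk
  k_le_v := hk
  card_block := by
    rintro B ⟨c, _, hc, rfl⟩
    exact hc
  card_containing := by
    intro T hT
    rw [← h T hT, ← Set.ncard_coe_finset, ← Set.ncard_image_of_injective _ wordSupport_injective]
    congr 1
    ext B
    simp only [supportBlocks, Set.mem_ofPred_eq, coe_filter, mem_codewords, Set.mem_image]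
    constructor
    · rintro ⟨⟨c, hc, hck, rfl⟩, hTc⟩
      exact ⟨c, ⟨hc, hck, fun i hi => by simpa [wordSupport] using hTc hi⟩, rfl⟩
    · rintro ⟨c, ⟨hc, hck, hTc⟩, rfl⟩
      exact ⟨⟨c, hc, hck, rfl⟩, fun i hi => by simpa [wordSupport] using hTc i hi⟩

/-- Double counting of pairs of a `t`-set and a word of weight `k` whose support contains it. -/
theorem mul_choose_eq_weightCount_mul [DecidableEq ι] (D : BinaryCode ι) {t k l : ℕ}
    (h : ∀ T : Finset ι, #T = t →
      #{x ∈ codewords D | hammingNorm x = k ∧ ∀ i ∈ T, x i ≠ 0} = l) :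
    l * (Fintype.card ι).choose t = weightCount D k * k.choose t := by
  have hcount := sum_card_bipartiteAbove_eq_sum_card_bipartiteBelow
    (s := powersetCard t (univ : Finset ι)) (t := {x ∈ codewords D | hammingNorm x = k})
    (fun T x => ∀ i ∈ T, x i ≠ 0)
  simp only [bipartiteAbove, bipartiteBelow, filter_filter] at hcount
  have hright : ∀ x ∈ ({x ∈ codewords D | hammingNorm x = k} : Finset (ι → ZMod 2)),
      #{T ∈ powersetCard t univ | ∀ i ∈ T, x i ≠ 0} = k.choose t := fun x hx => by
    rw [card_filter_subset_wordSupport, (mem_filter.1 hx).2]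
  rw [sum_congr rfl fun T hT => h T (mem_powersetCard.1 hT).2, sum_congr rfl hright] at hcount
  simpa [weightCount_eq_card, mul_comm] using hcount

theorem exists_isDesign_supportBlocks [DecidableEq ι] (D : BinaryCode ι) {t k : ℕ} (ht : 1 ≤ t)
    (htk : t ≤ k) (hk : k ≤ Fintype.card ι)
    (h : ∀ T T' : Finset ι, #T = t → #T' = t →
      #{x ∈ codewords D | hammingNorm x = k ∧ ∀ i ∈ T, x i ≠ 0} =
        #{x ∈ codewords D | hammingNorm x = k ∧ ∀ i ∈ T', x i ≠ 0}) :
    ∃ l : ℕ, (l : ℚ) =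
        (weightCount D k : ℚ) * (k.choose t : ℚ) / ((Fintype.card ι).choose t : ℚ) ∧
      IsDesign t (Fintype.card ι) k l (supportBlocks D k) := by
  obtain ⟨T₀, -, hT₀⟩ := exists_subset_card_eq (s := (univ : Finset ι)) (n := t)
    (by simpa using htk.trans hk)
  have h' := fun T hT => h T T₀ hT hT₀
  refine ⟨_, ?_, isDesign_supportBlocks D ht htk hk h'⟩
  rw [eq_div_iff (by exact_mod_cast (Nat.choose_pos (htk.trans hk)).ne')]
  exact_mod_cast mul_choose_eq_weightCount_mul D h'

/-- The Assmus–Mattson theorem for a code containing few weights other than those of the zero and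
the all-one vector: the number of codewords of a given weight whose support contains `T` depends
only on the size of `T`. -/
theorem card_codewords_containing_eq [DecidableEq ι] {D : BinaryCode ι} {d : ℕ}
    (hD : ∀ z ∈ dualCode D, hammingNorm z ≤ d → z = 0) {W : Finset ℕ}
    (hW : ∀ y ∈ D, y = 0 ∨ y = 1 ∨ hammingNorm y ∈ W) {T T' : Finset ι} (hT : #T = #T')
    (hd : #T + #W ≤ d + 1) (k : ℕ) :
    #{x ∈ codewords D | hammingNorm x = k ∧ ∀ i ∈ T, x i ≠ 0} =
      #{x ∈ codewords D | hammingNorm x = k ∧ ∀ i ∈ T', x i ≠ 0} := by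
  have key := sum_codewords_eq_of_card_eq hD hW hT hd
    (fun a w => if w = k ∧ a = #T then 1 else 0)
  rw [sum_boole, sum_boole] at key
  have hfilter : ∀ S : Finset ι, #S = #T → ∀ y : ι → ZMod 2,
      (#{i ∈ S | y i ≠ 0} = #T ↔ ∀ i ∈ S, y i ≠ 0) := by
    intro S hS y
    rw [← hS, card_filter_eq_iff]
  simp_rw [hfilter T rfl, hfilter T' hT.symm] at key
  exact_mod_cast key

/-- The Assmus–Mattson theorem for the dual code. -/
theorem card_dualCode_containing_eq [DecidableEq ι] {D : BinaryCode ι} {d : ℕ}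
    (hD : ∀ z ∈ dualCode D, hammingNorm z ≤ d → z = 0) {W : Finset ℕ}
    (hW : ∀ y ∈ D, y = 0 ∨ y = 1 ∨ hammingNorm y ∈ W) {T T' : Finset ι} (hT : #T = #T')
    (hd : #T + #W ≤ d + 1) (k : ℕ) :
    #{x ∈ codewords (dualCode D) | hammingNorm x = k ∧ ∀ i ∈ T, x i ≠ 0} =
      #{x ∈ codewords (dualCode D) | hammingNorm x = k ∧ ∀ i ∈ T', x i ≠ 0} := by
  -- Each term of the local MacWilliams identity depends on `y` only through its two weights.
  have key := sum_codewords_eq_of_card_eq hD hW hT hd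
    (fun a w => (localEnumerator (Fintype.card ι) #T a w).coeff k)
  rw [← card_mul_card_dualCode_eq, hT, ← card_mul_card_dualCode_eq] at key
  have hpos : (#(codewords D) : ℚ) ≠ 0 := by exact_mod_cast (card_codewords_pos D).ne'
  exact_mod_cast mul_left_cancel₀ hpos key

end Local

/-! ### Power moments and the dual distance -/

section SixthMoment

/-- Splitting off the last coordinate shifts the sign sum by ±1. For even powers the odd terms
cancel, which gives a recursion among even moments. -/
theorem sum_word_succ {n : ℕ} (F : ℚ → ℚ) :
    ∑ y : Fin (n + 1) → ZMod 2, F (∑ i, binSign (y i)) =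
      ∑ y : Fin n → ZMod 2, (F (∑ i, binSign (y i) + 1) + F (∑ i, binSign (y i) - 1)) := by
  rw [← (Fin.snocEquiv fun _ => ZMod 2).sum_comp, Fintype.sum_prod_type, ZMod.sum_two,
    ← sum_add_distrib]
  refine sum_congr rfl fun y _ => ?_
  simp [Fin.sum_univ_castSucc, Fin.snocEquiv, binSign_zero, binSign_one, sub_eq_add_neg]

theorem sum_binSign_sq (n : ℕ) :
    ∑ y : Fin n → ZMod 2, (∑ i, binSign (y i)) ^ 2 = 2 ^ n * n := by
  induction n with
  | zero => simp
  | succ n ih =>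
    rw [sum_word_succ (fun x => x ^ 2), sum_congr rfl fun y _ => show _ =
      2 * (∑ i, binSign (y i)) ^ 2 + 2 by ring, sum_add_distrib, ← mul_sum, ih]
    simp
    ring

theorem sum_binSign_pow_four (n : ℕ) :
    ∑ y : Fin n → ZMod 2, (∑ i, binSign (y i)) ^ 4 = 2 ^ n * (3 * n ^ 2 - 2 * n) := by
  induction n with
  | zero => simp
  | succ n ih =>
    rw [sum_word_succ (fun x => x ^ 4), sum_congr rfl fun y _ => show _ =
      2 * (∑ i, binSign (y i)) ^ 4 + 12 * (∑ i, binSign (y i)) ^ 2 + 2 by ring,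
      sum_add_distrib, sum_add_distrib, ← mul_sum, ← mul_sum, ih, sum_binSign_sq]
    simp
    ring

theorem sum_binSign_pow_six (n : ℕ) :
    ∑ y : Fin n → ZMod 2, (∑ i, binSign (y i)) ^ 6 =
      2 ^ n * (15 * n ^ 3 - 30 * n ^ 2 + 16 * n) := by
  induction n with
  | zero => simp
  | succ n ih =>
    rw [sum_word_succ (fun x => x ^ 6), sum_congr rfl fun y _ => show _ =
      2 * (∑ i, binSign (y i)) ^ 6 + 30 * (∑ i, binSign (y i)) ^ 4 +
        30 * (∑ i, binSign (y i)) ^ 2 + 2 by ring,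
      sum_add_distrib, sum_add_distrib, sum_add_distrib, ← mul_sum, ← mul_sum, ← mul_sum, ih,
      sum_binSign_sq, sum_binSign_pow_four]
    simp
    ring

variable {ι : Type*} [Fintype ι] [DecidableEq ι]

/-- The sum of the unit vectors indexed by a tuple of coordinates. -/
def tupleSum {ι : Type*} [DecidableEq ι] {r : ℕ} (f : Fin r → ι) : ι → ZMod 2 := ∑ j, Pi.single (f j) 1

-- Expanding the power gives a sum over `r`-tuples of characters, and orthogonality keeps the tuples
-- whose unit vectors sum into the dual.
open Classical in
theorem sum_codewords_binSign_pow (D : BinaryCode ι) (r : ℕ) :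
    ∑ y ∈ codewords D, (∑ i, binSign (y i)) ^ r =
      #(codewords D) * #{f : Fin r → ι | tupleSum f ∈ dualCode D} := by
  have h : ∀ f : Fin r → ι, ∑ y ∈ codewords D, ∏ j, binSign (y (f j)) =
      if tupleSum f ∈ dualCode D then (#(codewords D) : ℚ) else 0 := by
    intro f
    have : ∀ y : ι → ZMod 2, ∏ j, binSign (y (f j)) = binChar (tupleSum f) y := by
      intro y
      rw [tupleSum, binChar_sum]
      simp [binChar_single]
    simp_rw [this]
    split_ifs with hf
    · exact sum_binChar_of_mem hf
    · exact sum_binChar_of_notMem hf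
  simp_rw [Fintype.sum_pow]
  rw [sum_comm, sum_congr rfl fun f _ => h f, ← sum_filter, sum_const, nsmul_eq_mul, mul_comm]

/-- Repeating one coordinate twice changes nothing in characteristic 2, so short tuples can be
padded to length 6. -/
theorem exists_tupleSum_add_two {ι : Type*} [DecidableEq ι] [Nonempty ι] {r : ℕ}
    {z : ι → ZMod 2}
    (h : ∃ f : Fin r → ι, tupleSum f = z) : ∃ f : Fin (r + 2) → ι, tupleSum f = z := by
  obtain ⟨f, rfl⟩ := h
  let a := Classical.arbitrary ι
  refine ⟨Fin.cons a (Fin.cons a f), ?_⟩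
  have : (Pi.single a 1 : ι → ZMod 2) + Pi.single a 1 = 0 := by
    rw [← Pi.single_add, show (1 + 1 : ZMod 2) = 0 from rfl, Pi.single_zero]
  simp [tupleSum, Fin.sum_univ_succ, ← add_assoc, this]

theorem exists_tupleSum_hammingNorm (z : ι → ZMod 2) :
    ∃ f : Fin (hammingNorm z) → ι, tupleSum f = z := by
  let e : Fin (hammingNorm z) ≃ {i // i ∈ ({i | z i ≠ 0} : Finset ι)} :=
    (Finset.equivFin _).symm
  refine ⟨fun j => e j, ?_⟩
  rw [tupleSum, e.sum_comp (fun i : {i // i ∈ ({i | z i ≠ 0} : Finset ι)} =>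
    (Pi.single (i : ι) 1 : ι → ZMod 2)), sum_coe_sort _ fun i => (Pi.single i 1 : ι → ZMod 2)]
  funext i
  by_cases hi : z i = 0
  · simp [Pi.single_apply, hi]
  · simp [Pi.single_apply, ZMod.two_eq_one_of_ne_zero hi]

theorem even_hammingNorm_of_mem_dualCode {ι : Type*} [Fintype ι] {D : BinaryCode ι} (h1 : 1 ∈ D) {z : ι → ZMod 2}
    (hz : z ∈ dualCode D) : Even (hammingNorm z) := by
  have h := mem_dualCode.1 hz 1 h1
  rw [← ZMod.natCast_eq_zero_iff_even, hammingNorm, ← sum_boole]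
  refine Eq.trans ?_ h
  refine sum_congr rfl fun i _ => ?_
  by_cases hi : z i = 0
  · simp [hi]
  · simp [ZMod.two_eq_one_of_ne_zero hi]

/-- A code containing the all-one vector whose sixth power moment is that of the whole space has
dual distance at least eight. -/
theorem eq_zero_of_hammingNorm_le_seven {n : ℕ} {D : BinaryCode (Fin n)} (h1 : 1 ∈ D)
    (hD : ∑ y ∈ codewords D, (∑ i, binSign (y i)) ^ 6 =
      #(codewords D) * (15 * n ^ 3 - 30 * n ^ 2 + 16 * n)) {z : Fin n → ZMod 2}
    (hz : z ∈ dualCode D) (hz7 : hammingNorm z ≤ 7) : z = 0 := by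
  classical
  have htop := sum_codewords_binSign_pow (⊤ : BinaryCode (Fin n)) 6
  rw [codewords_top, sum_binSign_pow_six, card_univ] at htop
  rw [sum_codewords_binSign_pow] at hD
  have hcard : #{f : Fin 6 → Fin n | tupleSum f ∈ dualCode D} =
      #{f : Fin 6 → Fin n | tupleSum f ∈ dualCode (⊤ : BinaryCode (Fin n))} := by
    have hpos : (#(codewords D) : ℚ) ≠ 0 := by exact_mod_cast (card_codewords_pos D).ne'
    have h₁ := mul_left_cancel₀ hpos hD
    simp only [Fintype.card_fun, ZMod.card, Fintype.card_fin, Nat.cast_pow, Nat.cast_ofNat] at htop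
    have h₂ := mul_left_cancel₀ (by positivity) htop
    exact_mod_cast h₁.trans h₂
  -- Tuples with sum 0 count for every code; equal cardinalities leave no others.
  have hsub := eq_of_subset_of_card_le
    (s := {f : Fin 6 → Fin n | tupleSum f ∈ dualCode (⊤ : BinaryCode (Fin n))})
    (t := {f : Fin 6 → Fin n | tupleSum f ∈ dualCode D})
    (fun f hf => by
      rw [mem_filter] at hf ⊢
      rw [eq_zero_of_mem_dualCode_top hf.2]
      exact ⟨mem_univ _, Submodule.zero_mem _⟩) hcard.le
  by_contra hne
  obtain ⟨i, -⟩ := Function.ne_iff.1 hne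
  have : Nonempty (Fin n) := ⟨i⟩
  have hex : ∃ f : Fin 6 → Fin n, tupleSum f = z := by
    have h := exists_tupleSum_hammingNorm z
    obtain ⟨s, hs⟩ := even_hammingNorm_of_mem_dualCode h1 hz
    have hs3 : s ≤ 3 := by omega
    rw [hs] at h
    interval_cases s
    · exact exists_tupleSum_add_two (exists_tupleSum_add_two (exists_tupleSum_add_two h))
    · exact exists_tupleSum_add_two (exists_tupleSum_add_two h)
    · exact exists_tupleSum_add_two h
    · exact h
  obtain ⟨f, rfl⟩ := hex
  have hf : f ∈ ({f : Fin 6 → Fin n | tupleSum f ∈ dualCode D} : Finset _) := by simpa using hz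
  rw [← hsub, mem_filter] at hf
  exact hne (eq_zero_of_mem_dualCode_top hf.2)

end SixthMoment

/-! ### The dual of the extended dual code -/

section Extended

/-- The parity coordinate of an extended word is the sum of the others, so pairing with `x` amounts
to pairing the punctured word with `x i + x (last)`; the double dual then returns `C`. -/
theorem mem_dualCode_extendedCode_dualCode {n : ℕ} (C : BinaryCode (Fin n))
    (x : Fin (n + 1) → ZMod 2) :
    x ∈ dualCode (extendedCode (dualCode C)) ↔
      (fun i : Fin n => x i.castSucc + x (Fin.last n)) ∈ C := by
  conv_rhs => rw [← dualCode_dualCode C]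
  have hzero : ∀ a b : ZMod 2, a + b = 0 → a = b := by decide
  constructor
  · intro hx y hy
    have h := mem_dualCode.1 hx (Fin.snoc y (∑ i, y i))
      ⟨by simpa using hy, by
        rw [Fin.sum_univ_castSucc]
        simp [← two_mul, show (2 : ZMod 2) = 0 from rfl]⟩
    rw [Fin.sum_univ_castSucc] at h
    simpa [mul_add, sum_add_distrib, sum_mul] using h
  · rintro hx y ⟨hy, hy0⟩
    rw [Fin.sum_univ_castSucc] at hy0
    have h := mem_dualCode.1 hx _ hy
    rw [Fin.sum_univ_castSucc, ← hzero _ _ hy0, ← h]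
    simp [mul_add, sum_add_distrib, sum_mul]

theorem one_mem_dualCode_extendedCode {n : ℕ} (C : BinaryCode (Fin n)) :
    (1 : Fin (n + 1) → ZMod 2) ∈ dualCode (extendedCode C) := by
  rintro y ⟨-, hy⟩
  simpa using hy

theorem hammingNorm_add_one {n : ℕ} (c : Fin n → ZMod 2) :
    hammingNorm (c + 1) + hammingNorm c = n := by
  have h := card_filter_add_card_filter_not (s := (univ : Finset (Fin n))) (fun i => c i ≠ 0)
  have h2 : ∀ a : ZMod 2, a + 1 ≠ 0 ↔ ¬ a ≠ 0 := by decide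
  simp only [hammingNorm, Pi.add_apply, Pi.one_apply, h2]
  rw [card_univ, Fintype.card_fin] at h
  omega

theorem hammingNorm_snoc {n : ℕ} (c : Fin n → ZMod 2) (a : ZMod 2) :
    hammingNorm (Fin.snoc c a : Fin (n + 1) → ZMod 2) =
      hammingNorm c + if a = 0 then 0 else 1 := by
  simp only [hammingNorm, card_filter]
  rw [Fin.sum_univ_castSucc]
  simp [ite_not]

theorem weightCount_eq_sum {ι : Type*} [Fintype ι] [DecidableEq ι] (D : BinaryCode ι)
    [DecidablePred (· ∈ D)] (k : ℕ) :
    weightCount D k = ∑ x : ι → ZMod 2, if x ∈ D ∧ hammingNorm x = k then 1 else 0 := by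
  rw [sum_boole, weightCount_eq_card]
  simp only [Nat.cast_id]
  congr 1
  ext x; simp

/-- The two terms correspond to last coordinate 0 and 1; in the second case the remaining
coordinates form the complement of a word of `C`. -/
theorem weightCount_dualCode_extendedCode_dualCode {n : ℕ} (C : BinaryCode (Fin n)) {k : ℕ}
    (hk : k ≤ n + 1) :
    weightCount (dualCode (extendedCode (dualCode C))) k =
      weightCount C k + weightCount C (n + 1 - k) := by
  classical
  simp only [weightCount_eq_sum]
  rw [← (Fin.snocEquiv fun _ => ZMod 2).sum_comp, Fintype.sum_prod_type, ZMod.sum_two]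
  simp only [mem_dualCode_extendedCode_dualCode]
  congr 1
  · refine sum_congr rfl fun c _ => ?_
    simp [Fin.snocEquiv, hammingNorm_snoc]
  · refine Fintype.sum_equiv (Equiv.addRight 1) _ _ fun c => ?_
    have h := hammingNorm_add_one c
    have h' : hammingNorm c + 1 = k ↔ hammingNorm (c + 1) = n + 1 - k := by omega
    simp only [Fin.snocEquiv, Equiv.coe_fn_mk, hammingNorm_snoc, Fin.snoc_castSucc, Fin.snoc_last,
      one_ne_zero, if_false, Equiv.coe_addRight, h']
    rfl

end Extended

/-! ### Weight enumerators and signed binomial sums -/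

section Weights

theorem coeff_one_sub_X_pow (p j : ℕ) :
    ((1 - Polynomial.X : Polynomial ℚ) ^ p).coeff j = (-1) ^ j * p.choose j := by
  have : (1 - Polynomial.X : Polynomial ℚ) ^ p =
      ((1 + Polynomial.X) ^ p).comp (Polynomial.C (-1) * Polynomial.X) := by
    simp [sub_eq_add_neg]
  rw [this, Polynomial.comp_C_mul_X_coeff, Polynomial.coeff_one_add_X_pow, mul_comm]

theorem signedSum_eq_coeff (p q k : ℕ) :
    signedSum p q k =
      ((1 - Polynomial.X : Polynomial ℚ) ^ p * (1 + Polynomial.X) ^ q).coeff k := by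
  rw [Polynomial.coeff_mul, signedSum]
  refine sum_congr rfl fun ij _ => ?_
  rw [coeff_one_sub_X_pow, Polynomial.coeff_one_add_X_pow]

variable {ι : Type*} [Fintype ι]

theorem sum_codewords_hammingNorm (D : BinaryCode ι) (F : ℕ → ℚ) :
    ∑ y ∈ codewords D, F (hammingNorm y) =
      ∑ k ∈ range (Fintype.card ι + 1), weightCount D k * F k := by
  rw [← sum_fiberwise_of_maps_to (s := codewords D) (t := range (Fintype.card ι + 1))
    (g := fun y => hammingNorm y)
    fun y _ => mem_range.2 (Nat.lt_succ_of_le hammingNorm_le_card_fintype)]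
  refine sum_congr rfl fun k _ => ?_
  rw [sum_congr rfl fun y hy => by rw [(mem_filter.1 hy).2], sum_const, nsmul_eq_mul,
    weightCount_eq_card]

theorem hammingNorm_eq_card_iff {y : ι → ZMod 2} : hammingNorm y = Fintype.card ι ↔ y = 1 := by
  rw [hammingNorm, ← card_univ, card_filter_eq_iff]
  constructor
  · intro h
    exact funext fun i => ZMod.two_eq_one_of_ne_zero (h i (mem_univ i))
  · rintro rfl
    simp

theorem weightCount_ne_zero {D : BinaryCode ι} {y : ι → ZMod 2} (hy : y ∈ D) :
    weightCount D (hammingNorm y) ≠ 0 := by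
  rw [weightCount_eq_card]
  exact (card_pos.2 ⟨y, by simpa using hy⟩).ne'

theorem exists_of_weightCount_ne_zero {D : BinaryCode ι} {k : ℕ} (h : weightCount D k ≠ 0) :
    ∃ y ∈ D, hammingNorm y = k := by
  rw [weightCount_eq_card] at h
  obtain ⟨y, hy⟩ := card_pos.1 (Nat.pos_of_ne_zero h)
  exact ⟨y, by simpa using hy⟩

/-- The classical MacWilliams identity: the local one with `T` empty. -/
theorem card_mul_weightCount_dualCode [DecidableEq ι] (D : BinaryCode ι) (k : ℕ) :
    (#(codewords D) : ℚ) * weightCount (dualCode D) k =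
      ∑ w ∈ range (Fintype.card ι + 1),
        weightCount D w * signedSum w (Fintype.card ι - w) k := by
  have h := card_mul_card_dualCode_eq D ∅ k
  simp only [notMem_empty, false_implies, implies_true, and_true] at h
  rw [weightCount_eq_card, h, ← sum_codewords_hammingNorm D
    (fun w => signedSum w (Fintype.card ι - w) k)]
  refine sum_congr rfl fun y _ => ?_
  simp only [localEnumerator, card_empty, filter_empty, Nat.sub_zero, pow_zero, mul_one, one_mul]
  rw [mul_comm, signedSum_eq_coeff]

end Weights

/-! ### The explicit weight distributions -/

section Tables

variable {p P R : ℕ}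

/-- Writing m = 2p + 5, P = 2^p and R = P² makes every entry polynomial in `P` and `R` and every
weight linear, within reach of `ring` and `omega`. -/
theorem fiveWeightTable_eq (hP : P = 2 ^ p) (hR : R = P ^ 2) (w : ℕ) :
    fiveWeightTable (2 * p + 5) w =
      if w = 0 then (1 : ℚ)
      else if w = 16 * R - 8 * P then
        (32 * (R : ℚ) - 1) * P * (2 * P + 1) * (16 * R - 1) / 3
      else if w = 16 * R - 4 * P then
        (32 * (R : ℚ) - 1) * (2 * P) * (4 * P + 1) * (80 * R + 4) / 3
      else if w = 16 * R then (32 * (R : ℚ) - 1) * (576 * R ^ 2 + 12 * R + 1)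
      else if w = 16 * R + 4 * P then
        (32 * (R : ℚ) - 1) * (2 * P) * (4 * P - 1) * (80 * R + 4) / 3
      else if w = 16 * R + 8 * P then
        (32 * (R : ℚ) - 1) * P * (2 * P - 1) * (16 * R - 1) / 3
      else 0 := by
  unfold fiveWeightTable
  rw [show (2 * p + 5 - 1) = 2 * p + 4 by omega, show (2 * p + 5 + 1) / 2 = p + 3 by omega,
    show (2 * p + 4) / 2 = p + 2 by omega, show (2 * p + 5 - 5) / 2 = p by omega,
    show (2 * p + 5 - 3) / 2 = p + 1 by omega, show 2 * (2 * p + 5) - 4 = 4 * p + 6 by omega,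
    show 2 * p + 5 - 3 = 2 * p + 2 by omega]
  have h₁ : 2 ^ (2 * p + 4) = 16 * R := by rw [hR, hP]; ring
  have h₂ : 2 ^ (p + 3) = 8 * P := by rw [hP]; ring
  have h₃ : 2 ^ (p + 2) = 4 * P := by rw [hP]; ring
  have q₀ : (2 : ℚ) ^ (2 * p + 5) = 32 * R := by rw [hR, hP]; push_cast; ring
  have q₁ : (2 : ℚ) ^ (2 * p + 4) = 16 * R := by rw [hR, hP]; push_cast; ring
  have q₂ : (2 : ℚ) ^ p = P := by rw [hP]; push_cast; ring
  have q₃ : (2 : ℚ) ^ (p + 1) = 2 * P := by rw [hP]; push_cast; ring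
  have q₄ : (2 : ℚ) ^ (p + 2) = 4 * P := by rw [hP]; push_cast; ring
  have q₅ : (2 : ℚ) ^ (4 * p + 6) = 64 * R ^ 2 := by rw [hR, hP]; push_cast; ring
  have q₆ : (2 : ℚ) ^ (2 * p + 2) = 4 * R := by rw [hR, hP]; push_cast; ring
  rw [h₁, h₂, h₃, q₀, q₁, q₂, q₃, q₄, q₅, q₆]
  congr! 6 <;> ring

theorem coeffU_eq (hP : P = 2 ^ p) (hR : R = P ^ 2) :
    coeffU (2 * p + 5) = (2048 * R ^ 3 - 192 * R ^ 2 + 4 * R) / 3 := by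
  unfold coeffU
  rw [show 3 * (2 * p + 5) - 4 = 6 * p + 11 by omega,
    show 2 * (2 * p + 5) - 4 = 4 * p + 6 by omega, show 2 * p + 5 - 3 = 2 * p + 2 by omega, hR, hP]
  push_cast
  ring

theorem coeffV_eq (hP : P = 2 ^ p) (hR : R = P ^ 2) :
    coeffV (2 * p + 5) = (40960 * R ^ 3 + 768 * R ^ 2 - 64 * R) / 3 := by
  unfold coeffV
  rw [show 3 * (2 * p + 5) - 2 = 6 * p + 13 by omega,
    show 2 * (2 * p + 5) - 2 = 4 * p + 8 by omega, hR, hP]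
  push_cast
  ring

theorem coeffW_eq (hP : P = 2 ^ p) (hR : R = P ^ 2) :
    coeffW (2 * p + 5) = 2 * (32 * R - 1) * (576 * R ^ 2 + 12 * R + 1) := by
  unfold coeffW
  rw [show 2 * (2 * p + 5) - 4 = 4 * p + 6 by omega, show 2 * p + 5 - 3 = 2 * p + 2 by omega,
    hR, hP]
  push_cast
  ring

theorem dualExtendedTable_eq (hP : P = 2 ^ p) (hR : R = P ^ 2) (k : ℕ) :
    dualExtendedTable (2 * p + 5) k =
      if k = 0 then 1
      else if k = 16 * R - 8 * P then coeffU (2 * p + 5)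
      else if k = 16 * R - 4 * P then coeffV (2 * p + 5)
      else if k = 16 * R then coeffW (2 * p + 5)
      else if k = 16 * R + 4 * P then coeffV (2 * p + 5)
      else if k = 16 * R + 8 * P then coeffU (2 * p + 5)
      else if k = 32 * R then 1
      else 0 := by
  unfold dualExtendedTable
  rw [show (2 * p + 5 - 1) = 2 * p + 4 by omega, show (2 * p + 5 + 1) / 2 = p + 3 by omega,
    show (2 * p + 4) / 2 = p + 2 by omega]
  have h₀ : 2 ^ (2 * p + 5) = 32 * R := by rw [hR, hP]; ring
  have h₁ : 2 ^ (2 * p + 4) = 16 * R := by rw [hR, hP]; ring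
  have h₂ : 2 ^ (p + 3) = 8 * P := by rw [hP]; ring
  have h₃ : 2 ^ (p + 2) = 4 * P := by rw [hP]; ring
  rw [h₀, h₁, h₂, h₃]

theorem mem_weights_cases (k : ℕ) :
    k = 0 ∨ k = 16 * R - 8 * P ∨ k = 16 * R - 4 * P ∨ k = 16 * R ∨ k = 16 * R + 4 * P ∨
      k = 16 * R + 8 * P ∨ k = 32 * R ∨
      (k ≠ 0 ∧ k ≠ 16 * R - 8 * P ∧ k ≠ 16 * R - 4 * P ∧ k ≠ 16 * R ∧ k ≠ 16 * R + 4 * P ∧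
        k ≠ 16 * R + 8 * P ∧ k ≠ 32 * R) := by
  tauto

theorem fiveWeightTable_add (hP : P = 2 ^ p) (hR : R = P ^ 2) {k : ℕ} (hk : k ≤ 32 * R) :
    fiveWeightTable (2 * p + 5) k + fiveWeightTable (2 * p + 5) (32 * R - k) =
      dualExtendedTable (2 * p + 5) k := by
  have hP1 : 1 ≤ P := hP ▸ Nat.one_le_two_pow
  have hPR : P ≤ R := hR ▸ Nat.le_self_pow two_ne_zero P
  have hRq : (R : ℚ) = P ^ 2 := by rw [hR]; push_cast; ring
  rw [fiveWeightTable_eq hP hR, fiveWeightTable_eq hP hR, dualExtendedTable_eq hP hR,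
    coeffU_eq hP hR, coeffV_eq hP hR, coeffW_eq hP hR]
  have e₀ : 32 * R - 0 = 32 * R := by omega
  have e₁ : 32 * R - (16 * R - 8 * P) = 16 * R + 8 * P := by omega
  have e₂ : 32 * R - (16 * R - 4 * P) = 16 * R + 4 * P := by omega
  have e₃ : 32 * R - 16 * R = 16 * R := by omega
  have e₄ : 32 * R - (16 * R + 4 * P) = 16 * R - 4 * P := by omega
  have e₅ : 32 * R - (16 * R + 8 * P) = 16 * R - 8 * P := by omega
  have e₆ : 32 * R - 32 * R = 0 := by omega
  -- The listed weights are pairwise distinct because 1 ≤ P ≤ R; this selects the branches of the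
  -- tables.
  have a₁ : ¬ 16 * R - 8 * P = 0 := by omega
  have a₂ : ¬ 16 * R - 4 * P = 0 := by omega
  have a₃ : ¬ 16 * R = 0 := by omega
  have a₄ : ¬ 16 * R + 4 * P = 0 := by omega
  have a₅ : ¬ 16 * R + 8 * P = 0 := by omega
  have a₆ : ¬ 32 * R = 0 := by omega
  have b₂ : ¬ 16 * R - 4 * P = 16 * R - 8 * P := by omega
  have b₃ : ¬ 16 * R = 16 * R - 8 * P := by omega
  have b₄ : ¬ 16 * R + 4 * P = 16 * R - 8 * P := by omega
  have b₅ : ¬ 16 * R + 8 * P = 16 * R - 8 * P := by omega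
  have b₆ : ¬ 32 * R = 16 * R - 8 * P := by omega
  have c₃ : ¬ 16 * R = 16 * R - 4 * P := by omega
  have c₄ : ¬ 16 * R + 4 * P = 16 * R - 4 * P := by omega
  have c₅ : ¬ 16 * R + 8 * P = 16 * R - 4 * P := by omega
  have c₆ : ¬ 32 * R = 16 * R - 4 * P := by omega
  have d₄ : ¬ 16 * R + 4 * P = 16 * R := by omega
  have d₅ : ¬ 16 * R + 8 * P = 16 * R := by omega
  have d₆ : ¬ 32 * R = 16 * R := by omega
  have f₅ : ¬ 16 * R + 8 * P = 16 * R + 4 * P := by omega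
  have f₆ : ¬ 32 * R = 16 * R + 4 * P := by omega
  have g₆ : ¬ 32 * R = 16 * R + 8 * P := by omega
  rcases mem_weights_cases (P := P) (R := R) k with rfl | rfl | rfl | rfl | rfl | rfl | rfl | h
  · simp only [e₀, a₆, b₆, c₆, d₆, f₆, g₆, if_true, if_false]
    ring
  · simp only [e₁, a₁, a₅, b₅, c₅, d₅, f₅, if_true, if_false]
    rw [hRq]; ring
  · simp only [e₂, a₂, b₂, a₄, b₄, c₄, d₄, if_true, if_false]
    rw [hRq]; ring
  · simp only [e₃, a₃, b₃, c₃, if_true, if_false]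
    ring
  · simp only [e₄, a₂, b₂, a₄, b₄, c₄, d₄, if_true, if_false]
    rw [hRq]; ring
  · simp only [e₅, a₁, a₅, b₅, c₅, d₅, f₅, if_true, if_false]
    rw [hRq]; ring
  · simp only [e₆, a₆, b₆, c₆, d₆, f₆, g₆, if_true, if_false]
    ring
  · obtain ⟨h₀, h₁, h₂, h₃, h₄, h₅, h₆⟩ := h
    have i₀ : ¬ 32 * R - k = 0 := by omega
    have i₁ : ¬ 32 * R - k = 16 * R - 8 * P := by omega
    have i₂ : ¬ 32 * R - k = 16 * R - 4 * P := by omega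
    have i₃ : ¬ 32 * R - k = 16 * R := by omega
    have i₄ : ¬ 32 * R - k = 16 * R + 4 * P := by omega
    have i₅ : ¬ 32 * R - k = 16 * R + 8 * P := by omega
    simp only [h₀, h₁, h₂, h₃, h₄, h₅, h₆, i₀, i₁, i₂, i₃, i₄, i₅, if_false, add_zero]

theorem sum_dualExtendedTable_mul (hP : P = 2 ^ p) (hR : R = P ^ 2) (F : ℕ → ℚ) :
    ∑ k ∈ range (32 * R + 1), dualExtendedTable (2 * p + 5) k * F k =
      F 0 + F (32 * R) + coeffW (2 * p + 5) * F (16 * R)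
        + coeffU (2 * p + 5) * F (16 * R - 8 * P) + coeffV (2 * p + 5) * F (16 * R - 4 * P)
        + coeffV (2 * p + 5) * F (16 * R + 4 * P) + coeffU (2 * p + 5) * F (16 * R + 8 * P) := by
  have hP1 : 1 ≤ P := hP ▸ Nat.one_le_two_pow
  have hPR : P ≤ R := hR ▸ Nat.le_self_pow two_ne_zero P
  have hF : ∀ k, dualExtendedTable (2 * p + 5) k * F k =
      (if k = 0 then F k else 0) + (if k = 32 * R then F k else 0)
        + (if k = 16 * R then coeffW (2 * p + 5) * F k else 0)
        + (if k = 16 * R - 8 * P then coeffU (2 * p + 5) * F k else 0)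
        + (if k = 16 * R - 4 * P then coeffV (2 * p + 5) * F k else 0)
        + (if k = 16 * R + 4 * P then coeffV (2 * p + 5) * F k else 0)
        + (if k = 16 * R + 8 * P then coeffU (2 * p + 5) * F k else 0) := by
    intro k
    rw [dualExtendedTable_eq hP hR]
    split_ifs <;> first | omega | ring
  have hmem : ∀ j, j ≤ 32 * R → j ∈ range (32 * R + 1) := fun j hj => by
    rw [mem_range]; omega
  simp_rw [hF, sum_add_distrib, sum_ite_eq']
  rw [if_pos (hmem _ (by omega)), if_pos (hmem _ (by omega)), if_pos (hmem _ (by omega)),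
    if_pos (hmem _ (by omega)), if_pos (hmem _ (by omega)), if_pos (hmem _ (by omega)),
    if_pos (hmem _ (by omega))]

theorem signedSum_zero_left (q k : ℕ) : signedSum 0 q k = q.choose k := by
  rw [signedSum, sum_eq_single_of_mem (0, k) (by simp)]
  · simp
  · rintro ⟨i, j⟩ hij hne
    have hi : i ≠ 0 := by
      rintro rfl
      simp_all
    simp [Nat.choose_eq_zero_of_lt (Nat.pos_of_ne_zero hi)]

theorem signedSum_zero_right (q k : ℕ) : signedSum q 0 k = (-1) ^ k * q.choose k := by
  rw [signedSum, sum_eq_single_of_mem (k, 0) (by simp)]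
  · simp
  · rintro ⟨i, j⟩ hij hne
    have hj : j ≠ 0 := by
      rintro rfl
      simp_all
    simp [Nat.choose_eq_zero_of_lt (Nat.pos_of_ne_zero hj)]

/-- Here (1 - X)^q (1 + X)^q = (1 - X²)^q, so only even `k` survive. -/
theorem signedSum_self (q k : ℕ) :
    signedSum q q k = (1 + (-1) ^ k) / 2 * (-1) ^ (k / 2) * (q.choose (k / 2) : ℚ) := by
  have h : (1 - Polynomial.X : Polynomial ℚ) ^ q * (1 + Polynomial.X) ^ q =
      Polynomial.expand ℚ 2 ((1 - Polynomial.X) ^ q) := by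
    rw [← mul_pow]
    simp
    ring
  rw [signedSum_eq_coeff, h, Polynomial.coeff_expand two_pos, coeff_one_sub_X_pow]
  split_ifs with hk
  · rw [Even.neg_one_pow (even_iff_two_dvd.2 hk)]; ring
  · rw [Odd.neg_one_pow (Nat.not_even_iff_odd.1 fun h' => hk (even_iff_two_dvd.1 h'))]; ring

end Tables

/-! ### Application to the five-weight code -/

section Main

variable {m p P R : ℕ} {C : BinaryCode (Fin (2 ^ m - 1))}

theorem weightCount_dualCode_extendedCode_eq (hm : m = 2 * p + 5) (hP : P = 2 ^ p)
    (hR : R = P ^ 2) (hC : HasFiveWeightTable m C) (k : ℕ) :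
    (weightCount (dualCode (extendedCode (dualCode C))) k : ℚ) = dualExtendedTable m k := by
  subst hm
  have hN : 2 ^ (2 * p + 5) - 1 + 1 = 32 * R := by
    rw [Nat.sub_add_cancel Nat.one_le_two_pow, hR, hP]; ring
  by_cases hk : k ≤ 32 * R
  · rw [weightCount_dualCode_extendedCode_dualCode C (hN ▸ hk), Nat.cast_add, hC, hC, hN,
      fiveWeightTable_add hP hR hk]
  · have hP1 : 1 ≤ P := hP ▸ Nat.one_le_two_pow
    have hPR : P ≤ R := hR ▸ Nat.le_self_pow two_ne_zero P
    have h0 : weightCount (dualCode (extendedCode (dualCode C))) k = 0 := by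
      by_contra h
      obtain ⟨y, -, rfl⟩ := exists_of_weightCount_ne_zero h
      refine hk (hammingNorm_le_card_fintype.trans ?_)
      rw [Fintype.card_fin, hN]
    rw [h0, dualExtendedTable_eq hP hR]
    split_ifs <;> first | omega | simp

theorem sum_codewords_dualCode_extendedCode (hm : m = 2 * p + 5) (hP : P = 2 ^ p)
    (hR : R = P ^ 2) (hC : HasFiveWeightTable m C) (F : ℕ → ℚ) :
    ∑ w ∈ range (32 * R + 1), weightCount (dualCode (extendedCode (dualCode C))) w * F w =
      F 0 + F (32 * R) + coeffW m * F (16 * R)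
        + coeffU m * F (16 * R - 8 * P) + coeffV m * F (16 * R - 4 * P)
        + coeffV m * F (16 * R + 4 * P) + coeffU m * F (16 * R + 8 * P) := by
  simp_rw [weightCount_dualCode_extendedCode_eq hm hP hR hC]
  subst hm
  exact sum_dualExtendedTable_mul hP hR F

theorem card_fin_eq (hm : m = 2 * p + 5) (hP : P = 2 ^ p) (hR : R = P ^ 2) :
    Fintype.card (Fin (2 ^ m - 1 + 1)) = 32 * R := by
  rw [Fintype.card_fin, Nat.sub_add_cancel Nat.one_le_two_pow, hm, hR, hP]; ring

theorem card_codewords_dualCode_extendedCode (hm : m = 2 * p + 5) (hP : P = 2 ^ p)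
    (hR : R = P ^ 2) (hC : HasFiveWeightTable m C) :
    (#(codewords (dualCode (extendedCode (dualCode C)))) : ℚ) = 65536 * R ^ 3 := by
  have h := sum_codewords_hammingNorm (dualCode (extendedCode (dualCode C))) fun _ => 1
  rw [card_fin_eq hm hP hR, sum_codewords_dualCode_extendedCode hm hP hR hC] at h
  subst hm
  rw [coeffU_eq hP hR, coeffV_eq hP hR, coeffW_eq hP hR] at h
  simp only [sum_const, nsmul_eq_mul, mul_one] at h
  rw [h]
  ring

/-- The numerical heart: the sign sums over the words are ±32R, ±16P, ±8P and 0, and 2(32R)^6 +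
2u(16P)^6 + 2v(8P)^6 is the sixth moment required of a code with 65536 R³ words. -/
theorem eq_zero_of_mem_extendedCode (hm : m = 2 * p + 5) (hP : P = 2 ^ p)
    (hR : R = P ^ 2) (hC : HasFiveWeightTable m C) :
    ∀ z ∈ dualCode (dualCode (extendedCode (dualCode C))), hammingNorm z ≤ 7 → z = 0 := by
  have hP1 : 1 ≤ P := hP ▸ Nat.one_le_two_pow
  have hPR : P ≤ R := hR ▸ Nat.le_self_pow two_ne_zero P
  have hN := card_fin_eq hm hP hR
  have hN' : ((2 ^ m - 1 + 1 : ℕ) : ℚ) = 32 * R := by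
    rw [← Fintype.card_fin (2 ^ m - 1 + 1), hN]; push_cast; ring
  intro z hz hz7
  refine eq_zero_of_hammingNorm_le_seven (one_mem_dualCode_extendedCode _) ?_ hz hz7
  rw [card_codewords_dualCode_extendedCode hm hP hR hC, hN']
  simp_rw [sum_univ_binSign_eq]
  rw [sum_codewords_hammingNorm _ fun k => ((Fintype.card (Fin (2 ^ m - 1 + 1)) : ℚ) - 2 * k) ^ 6,
    hN, sum_codewords_dualCode_extendedCode hm hP hR hC]
  subst hm
  rw [coeffU_eq hP hR, coeffV_eq hP hR, coeffW_eq hP hR, Nat.cast_sub (by omega),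
    Nat.cast_sub (by omega)]
  push_cast
  rw [show (R : ℚ) = P ^ 2 by rw [hR]; push_cast; ring]
  ring

/-- The weights of the dual of the extended dual code, up to `0` and the length. -/
theorem weight_cases (hm : m = 2 * p + 5) (hP : P = 2 ^ p)
    (hR : R = P ^ 2) (hC : HasFiveWeightTable m C) :
    ∀ y ∈ dualCode (extendedCode (dualCode C)), y = 0 ∨ y = 1 ∨ hammingNorm y ∈
      ({16 * R - 8 * P, 16 * R - 4 * P, 16 * R, 16 * R + 4 * P, 16 * R + 8 * P} : Finset ℕ) := by
  intro y hy
  have h := weightCount_ne_zero hy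
  rw [← Nat.cast_ne_zero (R := ℚ), weightCount_dualCode_extendedCode_eq hm hP hR hC] at h
  rw [← hammingNorm_eq_zero, ← hammingNorm_eq_card_iff, card_fin_eq hm hP hR]
  subst hm
  rw [dualExtendedTable_eq hP hR] at h
  simp only [mem_insert, mem_singleton]
  by_contra hcon
  push Not at hcon
  obtain ⟨h₀, h₁, h₂, h₃, h₄, h₅, h₆⟩ := hcon
  simp [h₀, h₁, h₂, h₃, h₄, h₅, h₆] at h

theorem extendedDualFormula_eq (hm : m = 2 * p + 5) (hP : P = 2 ^ p) (hR : R = P ^ 2) (k : ℕ) :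
    extendedDualFormula m k =
      signedSum 0 (32 * R) k + signedSum (32 * R) 0 k + coeffW m * signedSum (16 * R) (16 * R) k
        + coeffU m * signedSum (16 * R - 8 * P) (16 * R + 8 * P) k
        + coeffV m * signedSum (16 * R - 4 * P) (16 * R + 4 * P) k
        + coeffV m * signedSum (16 * R + 4 * P) (16 * R - 4 * P) k
        + coeffU m * signedSum (16 * R + 8 * P) (16 * R - 8 * P) k := by
  rw [signedSum_self, signedSum_zero_left, signedSum_zero_right]
  unfold extendedDualFormula
  have e₀ : 2 ^ m = 32 * R := by rw [hm, hR, hP]; ring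
  have e₁ : 2 ^ (m - 1) = 16 * R := by
    rw [hm, show 2 * p + 5 - 1 = 2 * p + 4 by omega, hR, hP]; ring
  have e₂ : 2 ^ ((m + 1) / 2) = 8 * P := by
    rw [hm, show (2 * p + 5 + 1) / 2 = p + 3 by omega, hP]; ring
  have e₃ : 2 ^ ((m - 1) / 2) = 4 * P := by
    rw [hm, show (2 * p + 5 - 1) / 2 = p + 2 by omega, hP]; ring
  rw [e₀, e₁, e₂, e₃]
  ring

theorem weightCount_extendedCode_eq (hm : m = 2 * p + 5) (hP : P = 2 ^ p)
    (hR : R = P ^ 2) (hC : HasFiveWeightTable m C) (k : ℕ) :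
    2 ^ (3 * m + 1) * (weightCount (extendedCode (dualCode C)) k : ℚ) =
      extendedDualFormula m k := by
  have hP1 : 1 ≤ P := hP ▸ Nat.one_le_two_pow
  have hPR : P ≤ R := hR ▸ Nat.le_self_pow two_ne_zero P
  have h := card_mul_weightCount_dualCode (dualCode (extendedCode (dualCode C))) k
  rw [dualCode_dualCode, card_codewords_dualCode_extendedCode hm hP hR hC, card_fin_eq hm hP hR,
    sum_codewords_dualCode_extendedCode hm hP hR hC fun w => signedSum w (32 * R - w) k] at h
  rw [show (2 : ℚ) ^ (3 * m + 1) = 65536 * R ^ 3 by rw [hm, hR, hP]; push_cast; ring, h,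
    extendedDualFormula_eq hm hP hR]
  simp only [Nat.sub_zero, Nat.sub_self]
  rw [show 32 * R - 16 * R = 16 * R by omega,
    show 32 * R - (16 * R - 8 * P) = 16 * R + 8 * P by omega,
    show 32 * R - (16 * R - 4 * P) = 16 * R + 4 * P by omega,
    show 32 * R - (16 * R + 4 * P) = 16 * R - 4 * P by omega,
    show 32 * R - (16 * R + 8 * P) = 16 * R - 8 * P by omega]

end Main

theorem mainTheorem2 (m : ℕ) (hm : 5 ≤ m) (hodd : Odd m)
    (C : BinaryCode (Fin (2 ^ m - 1))) (hC : HasFiveWeightTable m C) :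
    ((∀ k : ℕ,
        (weightCount (dualCode (extendedCode (dualCode C))) k : ℚ) = dualExtendedTable m k) ∧
      ∀ k : ℕ, 1 ≤ k → weightCount (dualCode (extendedCode (dualCode C))) k ≠ 0 →
        ∃ l : ℕ,
          (l : ℚ) = (weightCount (dualCode (extendedCode (dualCode C))) k : ℚ)
            * (k.choose 3 : ℚ) / ((2 ^ m).choose 3 : ℚ) ∧
          IsDesign 3 (2 ^ m) k l (supportBlocks (dualCode (extendedCode (dualCode C))) k)) ∧
    ((∀ k : ℕ, k ≤ 2 ^ m →
        2 ^ (3 * m + 1) * (weightCount (extendedCode (dualCode C)) k : ℚ)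
          = extendedDualFormula m k) ∧
      ∀ k : ℕ, 1 ≤ k → weightCount (extendedCode (dualCode C)) k ≠ 0 →
        ∃ l : ℕ,
          (l : ℚ) = (weightCount (extendedCode (dualCode C)) k : ℚ)
            * (k.choose 3 : ℚ) / ((2 ^ m).choose 3 : ℚ) ∧
          IsDesign 3 (2 ^ m) k l (supportBlocks (extendedCode (dualCode C)) k)) := by
  obtain ⟨p, hp⟩ : ∃ p, m = 2 * p + 5 := by
    obtain ⟨q, hq⟩ := hodd
    exact ⟨q - 2, by omega⟩
  obtain ⟨P, hP⟩ : ∃ P, P = 2 ^ p := ⟨_, rfl⟩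
  obtain ⟨R, hR⟩ : ∃ R, R = P ^ 2 := ⟨_, rfl⟩
  have hP1 : 1 ≤ P := hP ▸ Nat.one_le_two_pow
  have hPR : P ≤ R := hR ▸ Nat.le_self_pow two_ne_zero P
  have hdist := eq_zero_of_mem_extendedCode hp hP hR hC
  have hwt := weight_cases hp hP hR hC
  have hcard := card_fin_eq hp hP hR
  have hpow : 2 ^ m = Fintype.card (Fin (2 ^ m - 1 + 1)) := by
    rw [Fintype.card_fin, Nat.sub_add_cancel Nat.one_le_two_pow]
  have hW : #({16 * R - 8 * P, 16 * R - 4 * P, 16 * R, 16 * R + 4 * P, 16 * R + 8 * P} :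
      Finset ℕ) ≤ 5 := card_le_five
  refine ⟨⟨weightCount_dualCode_extendedCode_eq hp hP hR hC, ?_⟩,
    fun k _ => weightCount_extendedCode_eq hp hP hR hC k, ?_⟩
  · intro k hk hne
    obtain ⟨y, hy, rfl⟩ := exists_of_weightCount_ne_zero hne
    -- The smallest nonzero weight is 16R - 8P ≥ 8.
    have h3 : 3 ≤ hammingNorm y := by
      rcases hwt y hy with rfl | rfl | h
      · simp at hk
      · rw [hammingNorm_eq_card_iff.2 rfl, hcard]; omega
      · simp only [mem_insert, mem_singleton] at h
        omega
    -- The bound holds with equality allowed: 3 points and at most 5 weights against 7 + 1.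
    have h := exists_isDesign_supportBlocks (dualCode (extendedCode (dualCode C))) (by norm_num)
      h3 hammingNorm_le_card_fintype fun T T' hT hT' =>
        card_codewords_containing_eq hdist hwt (hT.trans hT'.symm) (by omega) _
    rwa [← hpow] at h
  · intro k hk hne
    obtain ⟨y, hy, rfl⟩ := exists_of_weightCount_ne_zero hne
    have h3 : 3 ≤ hammingNorm y := by
      by_contra hlt
      rw [dualCode_dualCode] at hdist
      rw [hdist y hy (by omega)] at hk
      simp at hk
    -- The extended code is treated as the dual of its own dual, whose few weights drive the
    -- argument.
    have h := exists_isDesign_supportBlocks (dualCode (dualCode (extendedCode (dualCode C))))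
      (by norm_num) h3 hammingNorm_le_card_fintype fun T T' hT hT' =>
        card_dualCode_containing_eq hdist hwt (hT.trans hT'.symm) (by omega) _
    rwa [← hpow, dualCode_dualCode] at h
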